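/- A $k$-graph is a $k$-uniform hypergraph. For a $k$-graph $F$, let $\mathrm{ex}(n,F)$ be the maximum number of edges in a $k$-graph on $n$ vertices that contains no (not necessarily induced) subgraph isomorphic to $F$; the Turán density of $F$ is $\pi(F)=\lim_{n\to\infty}\mathrm{ex}(n,F)/\binom{n}{k}$. For a partition $\lambda=(\lambda_1\ge\cdots\ge\lambda_\ell)$ of $k$ with $\ell=\ell(\lambda)\ge 2$ parts, the $\lambda$-tent $\Delta_\lambda$ is the $k$-graph, unique up to isomorphism, whose edges are a base $e$ and $\ell$ further edges $e_1,\dots,e_\ell$, all containing a common vertex $v\notin e$ (the apex), such that $|e_i\cap e|=\lambda_i$ for every $i$ and $e_i\cap e_j=\{v\}$ for all $i\ne j$; its vertices are those that lie in these edges. **Theorem.** Let $k\ge 2$ be an integer, and let $\lambda$ be a partition of $k$ such that $\lambda_1\le\lceil k/2\rceil$ and $\lambda_i=1$ for all $1<i\le\ell(\lambda)$. (Then $\ell(\lambda)\ge 2$, so $\Delta_\lambda$ is defined.) Then the limit defining $\pi(\Delta_\lambda)$ exists and $$\pi(\Delta_\lambda)=\frac{k!}{k^k}.$$ -/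

import Mathlib

open Filter Topology

/-- A `k`-graph (`k`-uniform hypergraph) with vertex set `V` and finitely many edges. -/
structure KGraph (k : ℕ) (V : Type*) where
  /-- the set of edges -/
  edges : Finset (Finset V)
  /-- every edge has exactly `k` vertices -/
  uniform : ∀ e ∈ edges, e.card = k

namespace KGraph

/-- `G` is `F`-free: no (not necessarily induced) subgraph of `G` is isomorphic to `F`, that is,
no injection from the vertices of `F` to those of `G` sends all edges of `F` to edges of `G`. -/
def Free {k : ℕ} {V W : Type*} (F : KGraph k V) (G : KGraph k W) : Prop :=
  ¬ ∃ f : V ↪ W, ∀ e ∈ F.edges, e.map f ∈ G.edges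

/-- The Turán number `ex(n, F)`: the maximum number of edges of an `F`-free `k`-graph on `n`
vertices. -/
noncomputable def ex {k : ℕ} {V : Type*} (n : ℕ) (F : KGraph k V) : ℕ :=
  sSup {m : ℕ | ∃ G : KGraph k (Fin n), F.Free G ∧ G.edges.card = m}

/-- The supremum defining `ex(n, F)` is a maximum as soon as `F` has an edge. -/
theorem ex_isGreatest {k : ℕ} {V : Type*} (n : ℕ) (F : KGraph k V) (hF : F.edges.Nonempty) :
    IsGreatest {m : ℕ | ∃ G : KGraph k (Fin n), F.Free G ∧ G.edges.card = m} (F.ex n) := by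
  have hb : BddAbove {m : ℕ | ∃ G : KGraph k (Fin n), F.Free G ∧ G.edges.card = m} := by
    refine ⟨Fintype.card (Finset (Fin n)), ?_⟩
    rintro m ⟨G, -, rfl⟩
    exact Finset.card_le_univ _
  have hne : {m : ℕ | ∃ G : KGraph k (Fin n), F.Free G ∧ G.edges.card = m}.Nonempty := by
    refine ⟨0, ⟨∅, by simp⟩, ?_, by simp⟩
    rintro ⟨f, hf⟩
    obtain ⟨e, he⟩ := hF
    simpa using hf e he
  exact ⟨Nat.sSup_mem hne hb, fun m hm => le_csSup hb hm⟩

/-- `F` has Turán density `d`: the limit of `ex(n, F) / (n choose k)` as `n → ∞` exists and equals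
`d`. -/
def HasTuranDensity {k : ℕ} {V : Type*} (F : KGraph k V) (d : ℝ) : Prop :=
  Tendsto (fun n : ℕ => (F.ex n : ℝ) / (n.choose k : ℝ)) atTop (𝓝 d)

end KGraph

namespace Nat.Partition

/-- The length `ℓ(λ)` of a partition: its number of parts. -/
def len {k : ℕ} (lam : k.Partition) : ℕ := lam.parts.card

/-- The parts of `λ` in non-increasing order, indexed from `0`: `lam.part 0` is the largest part
`λ₁`, and `lam.part i` is `λ_{i+1}` (with value `0` for `i ≥ ℓ(λ)`). -/
def part {k : ℕ} (lam : k.Partition) (i : ℕ) : ℕ :=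
  (lam.parts.sort (· ≥ ·)).getD i 0

theorem sum_part {k : ℕ} (lam : k.Partition) : ∑ i : Fin lam.len, lam.part i = k := by
  have hlen : (lam.parts.sort (· ≥ ·)).length = lam.len := Multiset.length_sort _
  have hsum : (lam.parts.sort (· ≥ ·)).sum = k := by
    rw [← Multiset.sum_coe, Multiset.sort_eq, lam.parts_sum]
  rw [Fin.sum_univ_eq_sum_range (fun i => lam.part i), ← hlen]
  conv_rhs => rw [← hsum]
  rw [← Fin.sum_univ_eq_sum_range (fun i => lam.part i), ← List.sum_ofFn]
  congr 1
  apply List.ext_getElem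
  · simp
  · intro i h1 h2
    simp [part]

theorem part_pos {k : ℕ} (lam : k.Partition) (i : Fin lam.len) : 0 < lam.part i := by
  have hi : (i : ℕ) < (lam.parts.sort (· ≥ ·)).length := by
    rw [Multiset.length_sort]; exact i.2
  have hm : lam.part i ∈ lam.parts.sort (· ≥ ·) := by
    simp only [part, List.getD_eq_getElem _ _ hi]
    exact List.getElem_mem hi
  exact lam.parts_pos ((Multiset.mem_sort _).1 hm)

theorem part_lt {k : ℕ} (lam : k.Partition) (h : 2 ≤ lam.len) (i : Fin lam.len) :
    lam.part i < k := by
  have : Nontrivial (Fin lam.len) := Fin.nontrivial_iff_two_le.2 h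
  obtain ⟨j, hj⟩ := exists_ne i
  conv_rhs => rw [← lam.sum_part]
  exact Finset.single_lt_sum (f := fun i : Fin lam.len => lam.part i) hj (Finset.mem_univ i)
    (Finset.mem_univ j) (lam.part_pos j) (fun _ _ _ => Nat.zero_le _)

/-- A partition of `k ≥ 2` with largest part at most `⌈k/2⌉` has at least two parts, so its tent
is defined. -/
theorem two_le_len {k : ℕ} (hk : 2 ≤ k) (lam : k.Partition)
    (h : lam.part 0 ≤ ⌈(k : ℝ) / 2⌉₊) : 2 ≤ lam.len := by
  have hlt : ⌈(k : ℝ) / 2⌉₊ ≤ k - 1 := by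
    rw [Nat.ceil_le, Nat.cast_sub (by omega)]
    have : (2 : ℝ) ≤ k := by exact_mod_cast hk
    push_cast
    linarith
  by_contra hlen
  have hs := lam.sum_part
  rw [Fin.sum_univ_eq_sum_range (fun i => lam.part i)] at hs
  have : lam.len = 0 ∨ lam.len = 1 := by omega
  rcases this with h0 | h0 <;> rw [h0] at hs <;> simp at hs <;> omega

/-- The vertices of the `λ`-tent: the `k` base vertices, partitioned into blocks of sizes
`λ₁, …, λ_ℓ`; the apex; and, for each `i`, the `k - 1 - λ_i` remaining vertices of the edge `e_i`,
which lie in no other edge. -/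
abbrev TentVertex {k : ℕ} (lam : k.Partition) : Type :=
  (Σ i : Fin lam.len, Fin (lam.part i)) ⊕ Unit ⊕ (Σ i : Fin lam.len, Fin (k - 1 - lam.part i))

/-- The base `e` of the `λ`-tent. -/
def tentBase {k : ℕ} (lam : k.Partition) : Finset lam.TentVertex :=
  Finset.univ.disjSum ∅

/-- The edge `e_i` of the `λ`-tent: the `i`-th block of the base, the apex, and the `i`-th group of
remaining vertices. -/
def tentSide {k : ℕ} (lam : k.Partition) (i : Fin lam.len) : Finset lam.TentVertex :=
  (Finset.univ.map (Function.Embedding.sigmaMk i)).disjSum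
    (Finset.univ.disjSum (Finset.univ.map (Function.Embedding.sigmaMk i)))

/-- The `λ`-tent `Δ_λ`, for a partition `λ` of `k` with at least two parts: the `k`-graph whose
edges are the base `e` and `e_1, …, e_ℓ`, where every `e_i` contains the apex,
`|e_i ∩ e| = λ_i`, and `e_i ∩ e_j` consists of the apex alone for `i ≠ j`. -/
def tent {k : ℕ} (lam : k.Partition) (h : 2 ≤ lam.len) : KGraph k lam.TentVertex where
  edges := insert lam.tentBase (Finset.univ.image lam.tentSide)
  uniform := by
    intro e he
    rcases Finset.mem_insert.1 he with rfl | he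
    · simp [tentBase, lam.sum_part]
    · obtain ⟨i, -, rfl⟩ := Finset.mem_image.1 he
      have := lam.part_lt h i
      simp [tentSide, Finset.card_disjSum]
      omega

end Nat.Partition

/-! Lower bound: in a complete `k`-partite `k`-graph some base vertex shares the class of the apex,
and a side edge contains both, although every edge meets each class exactly once
(`free_tent_residuePartite`).

Upper bound, by entropy: deleting `O(n ^ (k - 1))` edges makes the graph clean (`exists_isClean`),
and then a base, an apex outside it and edges joining the apex to each block already yield a tent
(`not_free_tent_of_isClean`). Let `X` be a uniformly random ordered edge and `y m = exp H(X_i |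
X_A)` for `i ∉ A`, `|A| = k - m`; by symmetry only `m` matters. If `A ∪ B` is everything, a vertex
extending both `X_A` and `X_B` would be an apex: the largest block fits into `A` or `B`, and every
other block is a single vertex, hence lies in one of them. So the two sets of extensions are
disjoint, and Jensen's inequality turns this into `y a + y b ≤ y (a + b)`. Superadditivity and AM-GM
give `y 1 ⋯ y k ≤ k! (y k / k) ^ k`. The left side counts ordered edges by the chain rule, and `y k
≤ n`, so at most `(n / k) ^ k` edges survive the cleaning. -/

/-! ### Superadditive sequences -/

/-- A superadditive sequence satisfies `∑_{i ≤ n} y i / i ≤ y n`. -/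
theorem sum_div_le_of_superadditive {k : ℕ} {y : ℕ → ℝ}
    (h : ∀ i j, 1 ≤ i → 1 ≤ j → i + j ≤ k → y i + y j ≤ y (i + j)) (n : ℕ) (hn : n + 1 ≤ k) :
    ∑ i ∈ Finset.range (n + 1), y (i + 1) / ((i : ℝ) + 1) ≤ y (n + 1) := by
  induction n using Nat.strong_induction_on with
  | _ n ih =>
    -- Summation by parts: the term of index `i` occurs in `m - i = (m + 1) - (i + 1)` inner sums.
    have key : ∀ m : ℕ, ∑ j ∈ Finset.range m, ∑ i ∈ Finset.range (j + 1), y (i + 1) / ((i : ℝ) + 1)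
        = (m + 1) * ∑ i ∈ Finset.range m, y (i + 1) / ((i : ℝ) + 1)
          - ∑ i ∈ Finset.range m, y (i + 1) := by
      intro m
      induction m with
      | zero => simp
      | succ m ihm =>
        rw [Finset.sum_range_succ, ihm, Finset.sum_range_succ, Finset.sum_range_succ]
        have : (m : ℝ) + 1 ≠ 0 := by positivity
        push_cast
        field_simp
        ring
    have h1 : ∑ j ∈ Finset.range n, ∑ i ∈ Finset.range (j + 1), y (i + 1) / ((i : ℝ) + 1)
        ≤ ∑ j ∈ Finset.range n, y (j + 1) := by
      refine Finset.sum_le_sum fun j hj => ?_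
      have := Finset.mem_range.1 hj
      exact ih j this (by omega)
    -- Pair index `j + 1` with `n - j`; superadditivity bounds each pair by `y (n + 1)`.
    have h2 : ∑ j ∈ Finset.range n, y (j + 1) + ∑ j ∈ Finset.range n, y (j + 1)
        ≤ n * y (n + 1) := by
      nth_rw 2 [← Finset.sum_range_reflect]
      rw [← Finset.sum_add_distrib]
      calc _ ≤ ∑ _j ∈ Finset.range n, y (n + 1) := by
            refine Finset.sum_le_sum fun j hj => ?_
            have := Finset.mem_range.1 hj
            have h3 := h (j + 1) (n - 1 - j + 1) (by omega) (by omega) (by omega)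
            rwa [show j + 1 + (n - 1 - j + 1) = n + 1 by omega] at h3
        _ = _ := by simp
    rw [key] at h1
    rw [Finset.sum_range_succ]
    have hp : (0 : ℝ) < n + 1 := by positivity
    have h4 : ∑ i ∈ Finset.range n, y (i + 1) / ((i : ℝ) + 1) ≤ n * y (n + 1) / (n + 1) := by
      rw [le_div_iff₀ hp]
      linarith
    have h5 : n * y (n + 1) / ((n : ℝ) + 1) + y (n + 1) / ((n : ℝ) + 1) = y (n + 1) := by
      field_simp
    linarith

theorem prod_le_of_superadditive {k : ℕ} (hk : 1 ≤ k) {y : ℕ → ℝ} (hy : ∀ i, 0 < y i)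
    (h : ∀ i j, 1 ≤ i → 1 ≤ j → i + j ≤ k → y i + y j ≤ y (i + j)) :
    ∏ i ∈ Finset.range k, y (i + 1) ≤ k.factorial * (y k / k) ^ k := by
  have hk0 : (0 : ℝ) < k := by exact_mod_cast hk
  have hs : ∑ i ∈ Finset.range k, y (i + 1) / ((i : ℝ) + 1) ≤ y k := by
    have := sum_div_le_of_superadditive h (k - 1) (by omega)
    rwa [Nat.sub_add_cancel hk] at this
  have hyk := hy k
  -- AM-GM: after scaling, the `k` factors have sum at most `k`, and `t ≤ exp (t - 1)` bounds their
  -- product by `1`.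
  have h1 : ∏ i ∈ Finset.range k, (k / y k * (y (i + 1) / ((i : ℝ) + 1))) ≤ 1 := by
    calc _ ≤ ∏ i ∈ Finset.range k, Real.exp (k / y k * (y (i + 1) / ((i : ℝ) + 1)) - 1) := by
          refine Finset.prod_le_prod (fun i _ => ?_) fun i _ => ?_
          · have := hy (i + 1)
            positivity
          · have := Real.add_one_le_exp (k / y k * (y (i + 1) / ((i : ℝ) + 1)) - 1)
            linarith
      _ ≤ 1 := by
          rw [← Real.exp_sum, Real.exp_le_one_iff, Finset.sum_sub_distrib, ← Finset.mul_sum]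
          have : k / y k * ∑ i ∈ Finset.range k, y (i + 1) / ((i : ℝ) + 1) ≤ k / y k * y k := by
            gcongr
          rw [div_mul_cancel₀ _ hyk.ne'] at this
          simpa using this
  have hf : (k.factorial : ℝ) = ∏ i ∈ Finset.range k, ((i : ℝ) + 1) := by
    rw [← Finset.prod_range_add_one_eq_factorial]
    push_cast
    rfl
  rw [Finset.prod_mul_distrib, Finset.prod_const, Finset.card_range, Finset.prod_div_distrib,
    ← hf] at h1
  have hkf : (0 : ℝ) < k.factorial := by exact_mod_cast k.factorial_pos
  have h2 : (k / y k) ^ k * ((∏ i ∈ Finset.range k, y (i + 1)) / k.factorial)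
      * (k.factorial * (y k / k) ^ k) = ∏ i ∈ Finset.range k, y (i + 1) := by
    have : (k / y k) ^ k * (y k / k) ^ k = 1 := by
      rw [← mul_pow, div_mul_div_comm, mul_comm, div_self (by positivity), one_pow]
    calc _ = ((k / y k) ^ k * (y k / k) ^ k) * (∏ i ∈ Finset.range k, y (i + 1)) := by
          field_simp
      _ = _ := by rw [this, one_mul]
  rw [← h2]
  exact mul_le_of_le_one_left (by positivity) h1

/-! ### Entropy of a symmetric set of tuples -/

section Entropy

variable {ι V : Type*} [DecidableEq V]

/-- The number of `z ∈ Ω` that agree with `x` on `A`. -/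
def agree (Ω : Finset (ι → V)) (A : Finset ι) (x : ι → V) : ℕ :=
  (Ω.filter fun z => ∀ i ∈ A, z i = x i).card

/-- The average of `log (agree Ω A x)` over `x ∈ Ω`. The Shannon entropy of the restriction to `A`
of a uniformly random element of `Ω` is `log |Ω|` minus this quantity. -/
noncomputable def avgLogAgree (Ω : Finset (ι → V)) (A : Finset ι) : ℝ :=
  (∑ x ∈ Ω, Real.log (agree Ω A x)) / Ω.card

theorem agree_pos {Ω : Finset (ι → V)} (A : Finset ι) {x : ι → V} (hx : x ∈ Ω) :
    0 < agree Ω A x :=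
  Finset.card_pos.2 ⟨x, by simp [hx]⟩

theorem agree_congr (Ω : Finset (ι → V)) {A : Finset ι} {x z : ι → V}
    (h : ∀ i ∈ A, z i = x i) : agree Ω A z = agree Ω A x := by
  unfold agree
  congr 1
  ext w
  simp only [Finset.mem_filter, and_congr_right_iff]
  exact fun _ => forall₂_congr fun i hi => by rw [h i hi]

theorem agree_empty (Ω : Finset (ι → V)) (x : ι → V) : agree Ω ∅ x = Ω.card := by
  simp [agree]

theorem avgLogAgree_empty {Ω : Finset (ι → V)} (hΩ : Ω.Nonempty) :
    avgLogAgree Ω ∅ = Real.log Ω.card := by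
  have : (Ω.card : ℝ) ≠ 0 := by exact_mod_cast hΩ.card_pos.ne'
  simp only [avgLogAgree, agree_empty, Finset.sum_const, nsmul_eq_mul]
  field_simp

theorem avgLogAgree_univ [Fintype ι] (Ω : Finset (ι → V)) : avgLogAgree Ω Finset.univ = 0 := by
  unfold avgLogAgree
  rw [Finset.sum_eq_zero, zero_div]
  intro x hx
  have : agree Ω Finset.univ x = 1 := by
    refine Finset.card_eq_one.2 ⟨x, ?_⟩
    ext z
    simp only [Finset.mem_filter, Finset.mem_univ, forall_const, Finset.mem_singleton]
    exact ⟨fun h => funext h.2, fun h => ⟨h ▸ hx, fun i => congrFun h i⟩⟩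
  simp [this]

theorem agree_map {Ω : Finset (ι → V)} (hsymm : ∀ x ∈ Ω, ∀ σ : Equiv.Perm ι, x ∘ σ ∈ Ω)
    (σ : Equiv.Perm ι) (A : Finset ι) (x : ι → V) :
    agree Ω (A.map σ.toEmbedding) x = agree Ω A (x ∘ σ) := by
  refine Finset.card_bij (fun z _ => z ∘ σ) ?_ ?_ ?_
  · intro z hz
    simp only [Finset.mem_filter, Finset.mem_map_equiv] at hz ⊢
    exact ⟨hsymm z hz.1 σ, fun i hi => hz.2 _ (by simpa using hi)⟩
  · intro z _ w _ h
    exact σ.surjective.injective_comp_right h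
  · intro z hz
    simp only [Finset.mem_filter] at hz
    refine ⟨z ∘ σ.symm, ?_, by ext i; simp⟩
    simp only [Finset.mem_filter, Finset.mem_map_equiv]
    exact ⟨hsymm z hz.1 _, fun i hi => by simpa using hz.2 _ hi⟩

theorem avgLogAgree_map {Ω : Finset (ι → V)} (hsymm : ∀ x ∈ Ω, ∀ σ : Equiv.Perm ι, x ∘ σ ∈ Ω)
    (σ : Equiv.Perm ι) (A : Finset ι) :
    avgLogAgree Ω (A.map σ.toEmbedding) = avgLogAgree Ω A := by
  unfold avgLogAgree
  congr 1
  refine Finset.sum_bij (fun x _ => x ∘ σ) (fun x hx => hsymm x hx σ) ?_ ?_ ?_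
  · intro z _ w _ h
    exact σ.surjective.injective_comp_right h
  · intro z hz
    exact ⟨z ∘ σ.symm, hsymm z hz _, by ext i; simp⟩
  · intro x _
    rw [agree_map hsymm]

theorem exists_perm_map_eq [Finite ι] {A B : Finset ι} (h : A.card = B.card) :
    ∃ σ : Equiv.Perm ι, A.map σ.toEmbedding = B := by
  classical
  let e : {i // i ∈ A} ≃ {i // i ∈ B} := Finset.equivOfCardEq h
  refine ⟨e.extendSubtype, Finset.eq_of_subset_of_card_le ?_ (by simp [h])⟩
  intro j hj
  obtain ⟨i, hi, rfl⟩ := Finset.mem_map.1 hj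
  exact e.extendSubtype_mem i hi

/-- Permutation invariance makes the entropy of a restriction depend only on the number of
coordinates. -/
theorem avgLogAgree_eq_of_card_eq [Finite ι] {Ω : Finset (ι → V)}
    (hsymm : ∀ x ∈ Ω, ∀ σ : Equiv.Perm ι, x ∘ σ ∈ Ω) {A B : Finset ι} (h : A.card = B.card) :
    avgLogAgree Ω A = avgLogAgree Ω B := by
  obtain ⟨σ, rfl⟩ := exists_perm_map_eq h
  exact (avgLogAgree_map hsymm σ A).symm

/-- Jensen's inequality for the exponential of an average of logarithms. -/
theorem exp_avg_log_le {α : Type*} {s : Finset α} (hs : s.Nonempty) {t : α → ℝ}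
    (ht : ∀ x ∈ s, 0 < t x) :
    Real.exp ((∑ x ∈ s, Real.log (t x)) / s.card) ≤ (∑ x ∈ s, t x) / s.card := by
  have hc : (0 : ℝ) < s.card := by exact_mod_cast hs.card_pos
  have hT : 0 < (∑ x ∈ s, t x) / s.card := div_pos (Finset.sum_pos ht hs) hc
  rw [← Real.le_log_iff_exp_le hT, div_le_iff₀ hc]
  set T := (∑ x ∈ s, t x) / s.card with hTdef
  -- The tangent line to `log` at the mean `T`.
  have h1 : ∀ x ∈ s, Real.log (t x) ≤ t x / T - 1 + Real.log T := by
    intro x hx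
    have := Real.log_le_sub_one_of_pos (div_pos (ht x hx) hT)
    rw [Real.log_div (ht x hx).ne' hT.ne'] at this
    linarith
  refine (Finset.sum_le_sum h1).trans (le_of_eq ?_)
  rw [Finset.sum_add_distrib, Finset.sum_sub_distrib, ← Finset.sum_div]
  have : (∑ x ∈ s, t x) / T = s.card := by
    rw [hTdef]
    field_simp
    rw [div_self (Finset.sum_pos ht hs).ne']
  rw [this]
  simp
  ring

/-- This is `H(X_i) ≤ log |V|`: by Jensen, the left side is at most the mean of `1 / P(X_i = x i)`,
which counts the values that occur. -/
theorem exp_avgLogAgree_empty_le [Fintype V] {Ω : Finset (ι → V)} (hΩ : Ω.Nonempty) (i : ι) :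
    Real.exp (avgLogAgree Ω ∅ - avgLogAgree Ω {i}) ≤ Fintype.card V := by
  have hc : (0 : ℝ) < Ω.card := by exact_mod_cast hΩ.card_pos
  have hp : ∀ x ∈ Ω, (0 : ℝ) < agree Ω {i} x := fun x hx => by exact_mod_cast agree_pos _ hx
  calc _ = Real.exp ((∑ x ∈ Ω, Real.log (Ω.card / agree Ω {i} x)) / Ω.card) := by
        unfold avgLogAgree
        rw [← sub_div, ← Finset.sum_sub_distrib]
        congr 2
        refine Finset.sum_congr rfl fun x hx => ?_
        rw [Real.log_div hc.ne' (hp x hx).ne', agree_empty]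
    _ ≤ (∑ x ∈ Ω, (Ω.card / agree Ω {i} x : ℝ)) / Ω.card :=
        exp_avg_log_le hΩ fun x hx => div_pos hc (hp x hx)
    _ = ∑ x ∈ Ω, (1 / agree Ω {i} x : ℝ) := by
        rw [Finset.sum_div]
        refine Finset.sum_congr rfl fun x _ => ?_
        field_simp
    _ = ∑ v : V, ∑ x ∈ Ω with x i = v, (1 / agree Ω {i} x : ℝ) :=
        (Finset.sum_fiberwise _ _ _).symm
    _ ≤ ∑ _v : V, (1 : ℝ) := by
        refine Finset.sum_le_sum fun v _ => ?_
        have : ∀ x ∈ Ω.filter (fun x => x i = v), (1 / agree Ω {i} x : ℝ)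
            = 1 / (Ω.filter fun x => x i = v).card := by
          intro x hx
          simp only [agree, Finset.mem_singleton, forall_eq, (Finset.mem_filter.1 hx).2]
        rw [Finset.sum_congr rfl this, Finset.sum_const, nsmul_eq_mul, mul_one_div]
        exact div_self_le_one _
    _ = _ := by simp

/-- The values at `i` of the elements of `Ω` that agree with `x` on `A`. -/
def extensions (Ω : Finset (ι → V)) (A : Finset ι) (i : ι) (x : ι → V) : Finset V :=
  (Ω.filter fun z => ∀ j ∈ A, z j = x j).image fun z => z i

theorem mem_extensions {Ω : Finset (ι → V)} {A : Finset ι} {i : ι} {x : ι → V} {v : V} :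
    v ∈ extensions Ω A i x ↔ ∃ z ∈ Ω, (∀ j ∈ A, z j = x j) ∧ z i = v := by
  simp [extensions, and_assoc]

/-- The expected probability that a random `z` which agrees with a random `x` on `C` takes at `i` a
value that extends the restriction of `x` to `A`. -/
noncomputable def extProb (Ω : Finset (ι → V)) (C A : Finset ι) (i : ι) : ℝ :=
  (∑ x ∈ Ω, ((Ω.filter fun z => (∀ j ∈ C, z j = x j) ∧ z i ∈ extensions Ω A i x).card : ℝ)
    / agree Ω C x) / Ω.card

variable [DecidableEq ι]

/-- Double counting: the numerator at `w` counts pairs `(x, z)` agreeing with `w` on `A` and on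
`insert i C` respectively. For a fixed pair, the admissible `w` are either absent or form one class
of agreement on `insert i A`, whose size cancels. -/
theorem extProb_eq (Ω : Finset (ι → V)) {C A : Finset ι} (hCA : C ⊆ A) (i : ι) :
    ∑ x ∈ Ω, ((agree Ω A x : ℝ) * agree Ω (insert i C) x /
      (agree Ω (insert i A) x * agree Ω C x)) / Ω.card = extProb Ω C A i := by
  unfold extProb
  rw [← Finset.sum_div]
  congr 1
  have hl : ∀ w ∈ Ω, ((agree Ω A w : ℝ) * agree Ω (insert i C) w /
      (agree Ω (insert i A) w * agree Ω C w)) = ∑ x ∈ Ω, ∑ z ∈ Ω,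
        if ((∀ j ∈ A, x j = w j) ∧ ∀ j ∈ insert i C, z j = w j) then
          1 / ((agree Ω (insert i A) w : ℝ) * agree Ω C w) else 0 := by
    intro w _
    have : ((agree Ω A w : ℝ) * agree Ω (insert i C) w) = ∑ x ∈ Ω, ∑ z ∈ Ω,
        if ((∀ j ∈ A, x j = w j) ∧ ∀ j ∈ insert i C, z j = w j) then (1 : ℝ) else 0 := by
      unfold agree
      rw [Finset.card_filter, Finset.card_filter]
      push_cast
      rw [Finset.sum_mul_sum]
      refine Finset.sum_congr rfl fun x _ => Finset.sum_congr rfl fun z _ => ?_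
      split_ifs <;> simp_all
    rw [this, Finset.sum_div]
    refine Finset.sum_congr rfl fun x _ => ?_
    rw [Finset.sum_div]
    refine Finset.sum_congr rfl fun z _ => ?_
    split_ifs <;> simp
  rw [Finset.sum_congr rfl hl, Finset.sum_comm]
  refine Finset.sum_congr rfl fun x hx => ?_
  rw [Finset.sum_comm, Finset.card_filter]
  push_cast
  rw [Finset.sum_div]
  refine Finset.sum_congr rfl fun z hz => ?_
  rw [← Finset.sum_filter]
  by_cases hzx : (∀ j ∈ C, z j = x j) ∧ z i ∈ extensions Ω A i x
  · rw [if_pos hzx]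
    obtain ⟨hzC, hzi⟩ := hzx
    obtain ⟨w, hw, hwA, hwi⟩ := mem_extensions.1 hzi
    have hset : (Ω.filter fun u => (∀ j ∈ A, x j = u j) ∧ ∀ j ∈ insert i C, z j = u j)
        = Ω.filter fun u => ∀ j ∈ insert i A, u j = w j := by
      ext u
      simp only [Finset.mem_filter, Finset.forall_mem_insert, and_congr_right_iff]
      intro _
      constructor
      · rintro ⟨h1, h2, -⟩
        exact ⟨by rw [hwi, h2], fun j hj => by rw [hwA j hj, h1 j hj]⟩
      · rintro ⟨h1, h2⟩
        refine ⟨fun j hj => by rw [h2 j hj, hwA j hj], by rw [h1, hwi], fun j hj => ?_⟩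
        rw [hzC j hj, h2 j (hCA hj), hwA j (hCA hj)]
    rw [hset]
    have hterm : ∀ u ∈ Ω.filter (fun u => ∀ j ∈ insert i A, u j = w j),
        1 / ((agree Ω (insert i A) u : ℝ) * agree Ω C u)
          = 1 / ((agree Ω (insert i A) w : ℝ) * agree Ω C x) := by
      intro u hu
      have hu' := (Finset.mem_filter.1 hu).2
      rw [agree_congr Ω hu', agree_congr Ω (A := C) (x := x) (z := u)]
      intro j hj
      rw [hu' j (Finset.mem_insert_of_mem (hCA hj)), hwA j (hCA hj)]
    rw [Finset.sum_congr rfl hterm, Finset.sum_const, nsmul_eq_mul]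
    have h1 : (0 : ℝ) < agree Ω (insert i A) w := by exact_mod_cast agree_pos _ hw
    have h2 : (0 : ℝ) < agree Ω C x := by exact_mod_cast agree_pos _ hx
    change (agree Ω (insert i A) w : ℝ) * _ = _
    field_simp
  · rw [if_neg hzx, zero_div]
    refine Finset.sum_eq_zero fun u hu => ?_
    exfalso
    apply hzx
    obtain ⟨hu, h1, h2⟩ := Finset.mem_filter.1 hu
    rw [Finset.forall_mem_insert] at h2
    refine ⟨fun j hj => by rw [h2.2 j hj, h1 j (hCA hj)], mem_extensions.2 ⟨u, hu, ?_, h2.1.symm⟩⟩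
    exact fun j hj => (h1 j hj).symm

/-- The exponent `H(X_i | X_A) - H(X_i | X_C)` is the mean logarithm of the ratio averaged in
`extProb_eq`, so Jensen applies. -/
theorem exp_avgLogAgree_le {Ω : Finset (ι → V)} (hΩ : Ω.Nonempty) {C A : Finset ι} (hCA : C ⊆ A)
    (i : ι) : Real.exp ((avgLogAgree Ω A - avgLogAgree Ω (insert i A))
      - (avgLogAgree Ω C - avgLogAgree Ω (insert i C))) ≤ extProb Ω C A i := by
  rw [← extProb_eq Ω hCA i, ← Finset.sum_div]
  have hp : ∀ (B : Finset ι), ∀ x ∈ Ω, (0 : ℝ) < agree Ω B x :=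
    fun B x hx => by exact_mod_cast agree_pos B hx
  refine le_trans (le_of_eq ?_) (exp_avg_log_le hΩ fun x hx => ?_)
  · unfold avgLogAgree
    congr 1
    rw [← sub_div, ← sub_div, ← sub_div, ← Finset.sum_sub_distrib, ← Finset.sum_sub_distrib,
      ← Finset.sum_sub_distrib]
    congr 1
    refine Finset.sum_congr rfl fun x hx => ?_
    have h1 := (hp A x hx).ne'
    have h2 := (hp C x hx).ne'
    have h3 := (hp (insert i A) x hx).ne'
    have h4 := (hp (insert i C) x hx).ne'
    rw [Real.log_div (mul_ne_zero h1 h4) (mul_ne_zero h3 h2), Real.log_mul h1 h4,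
      Real.log_mul h3 h2]
    ring
  · have h1 := hp A x hx
    have h2 := hp C x hx
    have h3 := hp (insert i A) x hx
    have h4 := hp (insert i C) x hx
    positivity

/-- Swapping `i` and `j` fixes `C` pointwise and preserves `Ω`, so both events can be read off the
same coordinate `z i`, where they exclude each other. -/
theorem extProb_add_le_one {Ω : Finset (ι → V)}
    (hsymm : ∀ x ∈ Ω, ∀ σ : Equiv.Perm ι, x ∘ σ ∈ Ω) {C A B : Finset ι} {i j : ι}
    (hi : i ∉ C) (hj : j ∉ C)
    (hdisj : ∀ x ∈ Ω, Disjoint (extensions Ω A i x) (extensions Ω B j x)) :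
    extProb Ω C A i + extProb Ω C B j ≤ 1 := by
  unfold extProb
  rw [← add_div, ← Finset.sum_add_distrib]
  refine div_le_one_of_le₀ ?_ (by positivity)
  rw [Finset.cast_card]
  refine Finset.sum_le_sum fun x hx => ?_
  rw [← add_div]
  refine div_le_one_of_le₀ ?_ (by positivity)
  have hcard : (Ω.filter fun z => (∀ l ∈ C, z l = x l) ∧ z j ∈ extensions Ω B j x).card
      = (Ω.filter fun z => (∀ l ∈ C, z l = x l) ∧ z i ∈ extensions Ω B j x).card := by
    have hC : ∀ l ∈ C, Equiv.swap i j l = l := fun l hl =>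
      Equiv.swap_apply_of_ne_of_ne (fun h => hi (h ▸ hl)) (fun h => hj (h ▸ hl))
    refine Finset.card_bij (fun z _ => z ∘ Equiv.swap i j) ?_ ?_ ?_
    · intro z hz
      simp only [Finset.mem_filter, Function.comp_apply, Equiv.swap_apply_left] at hz ⊢
      exact ⟨hsymm z hz.1 _, fun l hl => by rw [hC l hl, hz.2.1 l hl], hz.2.2⟩
    · intro z _ w _ h
      exact (Equiv.swap i j).surjective.injective_comp_right h
    · intro z hz
      refine ⟨z ∘ Equiv.swap i j, ?_, by ext l; simp⟩
      simp only [Finset.mem_filter, Function.comp_apply, Equiv.swap_apply_right] at hz ⊢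
      exact ⟨hsymm z hz.1 _, fun l hl => by rw [hC l hl, hz.2.1 l hl], hz.2.2⟩
  rw [hcard]
  classical
  have hu := Finset.card_union_of_disjoint
    (s := Ω.filter fun z => (∀ l ∈ C, z l = x l) ∧ z i ∈ extensions Ω A i x)
    (t := Ω.filter fun z => (∀ l ∈ C, z l = x l) ∧ z i ∈ extensions Ω B j x) (by
      rw [Finset.disjoint_filter]
      exact fun z _ h1 h2 => Finset.disjoint_left.1 (hdisj x hx) h1.2 h2.2)
  rw [← Nat.cast_add, ← hu]
  norm_cast
  refine Finset.card_le_card fun z hz => ?_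
  simp only [Finset.mem_union, Finset.mem_filter] at hz ⊢
  tauto

end Entropy

/-! ### The entropy bound -/

/-- A symmetric set of `k`-tuples in which the extensions of complementary restrictions are
disjoint has at most `k! (n / k) ^ k` elements. -/
theorem card_le_of_disjoint_extensions {k : ℕ} (hk : 1 ≤ k) {V : Type*} [Fintype V]
    [DecidableEq V] {Ω : Finset (Fin k → V)}
    (hsymm : ∀ x ∈ Ω, ∀ σ : Equiv.Perm (Fin k), x ∘ σ ∈ Ω)
    (hdisj : ∀ x ∈ Ω, ∀ A B : Finset (Fin k), A ∪ B = Finset.univ → ∀ i ∉ A, ∀ j ∉ B,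
      Disjoint (extensions Ω A i x) (extensions Ω B j x)) :
    (Ω.card : ℝ) ≤ k.factorial * ((Fintype.card V : ℝ) / k) ^ k := by
  rcases Ω.eq_empty_or_nonempty with rfl | hΩ
  · simp
    positivity
  let init : ℕ → Finset (Fin k) := fun s => Finset.univ.filter fun i => (i : ℕ) < s
  have hinit : ∀ s ≤ k, (init s).card = s := by
    intro s hs
    rw [Fin.card_filter_val_lt, min_eq_right hs]
  -- The index `m` counts the coordinates not conditioned on; initial segments are mere
  -- representatives, by `hyA`.
  let y : ℕ → ℝ := fun m =>
    Real.exp (avgLogAgree Ω (init (k - m)) - avgLogAgree Ω (init (k - m + 1)))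
  have hyA : ∀ (m : ℕ) (A : Finset (Fin k)) (i : Fin k), i ∉ A → A.card + m = k →
      y m = Real.exp (avgLogAgree Ω A - avgLogAgree Ω (insert i A)) := by
    intro m A i hi hA
    have h1 : (insert i A).card ≤ k := by simpa using Finset.card_le_univ (insert i A)
    rw [Finset.card_insert_of_notMem hi] at h1
    simp only [y]
    rw [avgLogAgree_eq_of_card_eq hsymm (A := init (k - m)) (B := A),
      avgLogAgree_eq_of_card_eq hsymm (A := init (k - m + 1)) (B := insert i A)]
    · rw [Finset.card_insert_of_notMem hi, hinit _ (by omega)]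
      omega
    · rw [hinit _ (by omega)]
      omega
  have hsuper : ∀ i j, 1 ≤ i → 1 ≤ j → i + j ≤ k → y i + y j ≤ y (i + j) := by
    intro a b ha hb hab
    -- The complements of `A` and `B` are consecutive blocks of lengths `a` and `b`, starting at `i`
    -- and `j`; `C` is `A ∩ B`.
    let A : Finset (Fin k) := Finset.univ.filter fun l => ¬ (l : ℕ) < a
    let B : Finset (Fin k) := Finset.univ.filter fun l => (l : ℕ) < a ∨ a + b ≤ (l : ℕ)
    let C : Finset (Fin k) := Finset.univ.filter fun l => ¬ (l : ℕ) < a + b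
    let i : Fin k := ⟨0, by omega⟩
    let j : Fin k := ⟨a, by omega⟩
    have hiA : i ∉ A := by simp [A, i]; omega
    have hjB : j ∉ B := by simp [B, j]; omega
    have hCA : C ⊆ A := by
      intro l; simp [C, A]; omega
    have hCB : C ⊆ B := by
      intro l; simp [C, B]; omega
    have hiC : i ∉ C := fun h => hiA (hCA h)
    have hjC : j ∉ C := fun h => hjB (hCB h)
    have hAc : A.card + a = k := by
      have := Finset.card_filter_add_card_filter_not (s := (Finset.univ : Finset (Fin k)))
        (fun l => (l : ℕ) < a)
      rw [Fin.card_filter_val_lt, min_eq_right (by omega), Finset.card_univ, Fintype.card_fin]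
        at this
      change _ + A.card = _ at this
      omega
    have hCc : C.card + (a + b) = k := by
      have := Finset.card_filter_add_card_filter_not (s := (Finset.univ : Finset (Fin k)))
        (fun l => (l : ℕ) < a + b)
      rw [Fin.card_filter_val_lt, min_eq_right (by omega), Finset.card_univ, Fintype.card_fin]
        at this
      change _ + C.card = _ at this
      omega
    have hBc : B.card + b = k := by
      have hB : B = init a ∪ C := by
        ext l; simp [B, C, init]
      rw [hB, Finset.card_union_of_disjoint, hinit a (by omega)]
      · omega
      · rw [Finset.disjoint_filter]
        intro l _ h1
        omega
    have hAB : A ∪ B = Finset.univ := by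
      ext l; simp [A, B]; omega
    have h1 := exp_avgLogAgree_le hΩ hCA i
    have h2 := exp_avgLogAgree_le hΩ hCB j
    have h3 := extProb_add_le_one hsymm hiC hjC fun x hx => hdisj x hx A B hAB i hiA j hjB
    rw [Real.exp_sub, ← hyA a A i hiA hAc, ← hyA (a + b) C i hiC hCc] at h1
    rw [Real.exp_sub, ← hyA b B j hjB hBc, ← hyA (a + b) C j hjC hCc] at h2
    have h4 : y a / y (a + b) + y b / y (a + b) ≤ 1 := by linarith
    rwa [← add_div, div_le_one (Real.exp_pos _)] at h4
  have hprod := prod_le_of_superadditive hk (y := y) (fun i => Real.exp_pos _) hsuper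
  have hyk : y k ≤ Fintype.card V := by
    have i : Fin k := ⟨0, by omega⟩
    rw [hyA k ∅ i (by simp) (by simp)]
    exact exp_avgLogAgree_empty_le hΩ i
  -- Chain rule: the conditional entropies telescope to `log |Ω|`.
  have hcard : ∏ i ∈ Finset.range k, y (i + 1) = Ω.card := by
    rw [← Finset.prod_range_reflect]
    have : ∀ s ∈ Finset.range k, y (k - 1 - s + 1)
        = Real.exp (avgLogAgree Ω (init s) - avgLogAgree Ω (init (s + 1))) := by
      intro s hs
      have := Finset.mem_range.1 hs
      simp only [y]
      rw [show k - (k - 1 - s + 1) = s by omega]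
    rw [Finset.prod_congr rfl this, ← Real.exp_sum, Finset.sum_range_sub']
    have h0 : init 0 = ∅ := by simp [init]
    have h1 : init k = Finset.univ := by simp [init]
    rw [h0, h1, avgLogAgree_univ, avgLogAgree_empty hΩ, sub_zero, Real.exp_log]
    exact_mod_cast hΩ.card_pos
  rw [← hcard]
  refine hprod.trans ?_
  have : 0 ≤ y k := (Real.exp_pos _).le
  gcongr

/-! ### Cleaning a family of `k`-sets -/

theorem sum_pow_card_le {V : Type*} [Fintype V] (k c : ℕ) :
    ∑ S : Finset V with S.card < k, c * Fintype.card V ^ (k - 1 - S.card)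
      ≤ k * (c * Fintype.card V ^ (k - 1)) := by
  have hmaps : ∀ S ∈ (Finset.univ : Finset (Finset V)).filter (fun S => S.card < k),
      S.card ∈ Finset.range k := fun S hS => Finset.mem_range.2 (Finset.mem_filter.1 hS).2
  rw [← Finset.sum_fiberwise_of_maps_to hmaps]
  calc _ ≤ ∑ _s ∈ Finset.range k, c * Fintype.card V ^ (k - 1) := by
        refine Finset.sum_le_sum fun s hs => ?_
        have hs' := Finset.mem_range.1 hs
        calc _ ≤ ∑ S ∈ (Finset.univ : Finset V).powersetCard s,
              c * Fintype.card V ^ (k - 1 - s) := by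
              refine le_trans (le_of_eq ?_) (Finset.sum_le_sum_of_subset (s := Finset.filter
                (fun S => S.card = s) (Finset.univ.filter fun S : Finset V => S.card < k)) ?_)
              · exact Finset.sum_congr rfl fun S hS => by rw [(Finset.mem_filter.1 hS).2]
              · intro S hS
                simp [Finset.mem_powersetCard, (Finset.mem_filter.1 hS).2]
          _ = c * ((Fintype.card V).choose s * Fintype.card V ^ (k - 1 - s)) := by
              rw [Finset.sum_const, Finset.card_powersetCard, Finset.card_univ, smul_eq_mul]
              ring
          _ ≤ c * (Fintype.card V ^ s * Fintype.card V ^ (k - 1 - s)) := by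
              gcongr
              exact Nat.choose_le_pow _ _
          _ = _ := by
              rw [← pow_add, show s + (k - 1 - s) = k - 1 by omega]
    _ = _ := by simp

section Cleaning

variable {V : Type*} [DecidableEq V]

/-- `E` is `w`-clean: every subset of an edge extends to an edge that avoids any prescribed `w`
further vertices. -/
def IsClean (w : ℕ) (E : Finset (Finset V)) : Prop :=
  ∀ e ∈ E, ∀ S ⊆ e, ∀ W : Finset V, Disjoint S W → W.card ≤ w → ∃ f ∈ E, S ⊆ f ∧ Disjoint f W

/-- Greedy choice: each new edge avoids the base and all earlier edges outside `insert v (I a)`;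
these have at most `k + s.card * k` vertices. -/
theorem IsClean.exists_disjoint_extensions {ι : Type*} [DecidableEq ι] {k w : ℕ}
    {E : Finset (Finset V)} (hE : ∀ e ∈ E, e.card = k) (hclean : IsClean w E) {e : Finset V}
    (he : e.card = k) {v : V} (hv : v ∉ e) {I : ι → Finset V} (hIe : ∀ i, I i ⊆ e)
    (hI : ∀ i j, i ≠ j → Disjoint (I i) (I j)) (hcov : ∀ i, ∃ f ∈ E, insert v (I i) ⊆ f)
    (s : Finset ι) (hs : k + s.card * k ≤ w) :
    ∃ f : ι → Finset V, (∀ i ∈ s, f i ∈ E ∧ insert v (I i) ⊆ f i ∧ f i ∩ e ⊆ I i) ∧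
      ∀ i ∈ s, ∀ j ∈ s, i ≠ j → f i ∩ f j ⊆ {v} := by
  induction s using Finset.induction_on with
  | empty => exact ⟨fun _ => ∅, by simp, by simp⟩
  | insert a s ha ih =>
    rw [Finset.card_insert_of_notMem ha] at hs
    obtain ⟨f, hf, hff⟩ := ih (by nlinarith)
    obtain ⟨g, hgE, hg⟩ := hcov a
    let W := (e ∪ s.biUnion f) \ insert v (I a)
    have hW : W.card ≤ w := by
      calc W.card ≤ (e ∪ s.biUnion f).card := Finset.card_le_card Finset.sdiff_subset
        _ ≤ e.card + (s.biUnion f).card := Finset.card_union_le _ _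
        _ ≤ k + s.card * k := by
            refine add_le_add he.le (Finset.card_biUnion_le_card_mul _ _ _ fun i hi => ?_)
            exact (hE _ (hf i hi).1).le
        _ ≤ w := by nlinarith
    obtain ⟨f₀, hf₀E, hf₀, hf₀W⟩ := hclean g hgE _ hg W Finset.disjoint_sdiff hW
    have hmem : ∀ u ∈ f₀, u ∈ e ∪ s.biUnion f → u = v ∨ u ∈ I a := by
      intro u hu hu'
      by_contra! hn
      refine Finset.disjoint_left.1 hf₀W hu (Finset.mem_sdiff.2 ⟨hu', ?_⟩)
      simp [hn]
    have hnew : ∀ j ∈ s, f₀ ∩ f j ⊆ {v} := by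
      intro j hj u hu
      obtain ⟨hu₀, huj⟩ := Finset.mem_inter.1 hu
      rcases hmem u hu₀ (Finset.mem_union_right _ (Finset.mem_biUnion.2 ⟨j, hj, huj⟩)) with h | h
      · simp [h]
      -- A vertex of `I a` in `f j` lies in the base, hence in `I j`, which is disjoint from `I a`.
      · exact absurd ((hf j hj).2.2 (Finset.mem_inter.2 ⟨huj, hIe a h⟩))
          (Finset.disjoint_left.1 (hI a j (by rintro rfl; exact ha hj)) h)
    have hupd : ∀ j ∈ s, Function.update f a f₀ j = f j := fun j hj =>
      Function.update_of_ne (by rintro rfl; exact ha hj) _ _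
    refine ⟨Function.update f a f₀, ?_, ?_⟩
    · intro i hi
      rcases Finset.mem_insert.1 hi with rfl | hi
      · rw [Function.update_self]
        refine ⟨hf₀E, hf₀, fun u hu => ?_⟩
        obtain ⟨hu₀, hue⟩ := Finset.mem_inter.1 hu
        rcases hmem u hu₀ (Finset.mem_union_left _ hue) with rfl | h
        · exact absurd hue hv
        · exact h
      · rw [hupd i hi]
        exact hf i hi
    · intro i hi j hj hij
      rcases Finset.mem_insert.1 hi with rfl | hi' <;> rcases Finset.mem_insert.1 hj with rfl | hj'
      · exact absurd rfl hij
      · rw [Function.update_self, hupd j hj']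
        exact hnew j hj'
      · rw [Function.update_self, hupd _ hi', Finset.inter_comm]
        exact hnew _ hi'
      · rw [hupd i hi', hupd j hj']
        exact hff i hi' j hj' hij

variable [Fintype V]

theorem card_filter_superset_le {k : ℕ} {E : Finset (Finset V)} (hE : ∀ e ∈ E, e.card = k)
    (T : Finset V) :
    (E.filter fun e => T ⊆ e).card ≤ Fintype.card V ^ (k - T.card) := by
  calc _ ≤ ((Finset.univ : Finset V).powersetCard (k - T.card)).card := by
        refine Finset.card_le_card_of_injOn (fun e => e \ T) ?_ ?_
        · intro e he
          obtain ⟨he, hT⟩ := Finset.mem_filter.1 he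
          simp [Finset.mem_powersetCard, Finset.card_sdiff_of_subset hT, hE e he]
        · intro e he f hf hef
          rw [← Finset.sdiff_union_of_subset (Finset.mem_filter.1 he).2,
            ← Finset.sdiff_union_of_subset (Finset.mem_filter.1 hf).2]
          exact congrArg (· ∪ T) hef
    _ ≤ _ := by
        rw [Finset.card_powersetCard, Finset.card_univ]
        exact Nat.choose_le_pow _ _

theorem card_filter_superset_not_disjoint_le {k : ℕ} {E : Finset (Finset V)}
    (hE : ∀ e ∈ E, e.card = k) {S W : Finset V} (hSW : Disjoint S W) :
    (E.filter fun e => S ⊆ e ∧ ¬ Disjoint e W).card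
      ≤ W.card * Fintype.card V ^ (k - 1 - S.card) := by
  calc _ ≤ (W.biUnion fun u => E.filter fun e => insert u S ⊆ e).card := by
        refine Finset.card_le_card fun e he => ?_
        obtain ⟨he, hS, hW⟩ := Finset.mem_filter.1 he
        obtain ⟨u, hue, huW⟩ := Finset.not_disjoint_iff.1 hW
        exact Finset.mem_biUnion.2
          ⟨u, huW, Finset.mem_filter.2 ⟨he, Finset.insert_subset hue hS⟩⟩
    _ ≤ _ := by
        refine Finset.card_biUnion_le_card_mul _ _ _ fun u hu => ?_
        refine (card_filter_superset_le hE _).trans (le_of_eq ?_)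
        rw [Finset.card_insert_of_notMem (Finset.disjoint_right.1 hSW hu)]
        congr 1
        omega

/-- Every family of `k`-sets becomes `w`-clean after the deletion of `O(n ^ (k - 1))` members. -/
theorem exists_isClean {k : ℕ} {E : Finset (Finset V)} (hE : ∀ e ∈ E, e.card = k) (w : ℕ) :
    ∃ E' ⊆ E, IsClean w E' ∧
      E.card ≤ E'.card + k * ((w + 1) * Fintype.card V ^ (k - 1)) := by
  let U : Finset (Finset V) → Finset (Finset V) := fun F =>
    (Finset.univ.filter fun S : Finset V => S.card < k).filter fun S => ∀ f ∈ F, ¬ S ⊆ f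
  let wt : Finset V → ℕ := fun S => (w + 1) * Fintype.card V ^ (k - 1 - S.card)
  -- Maximality replaces iterated deletion. If `S` violates cleanness, removing all edges above `S`
  -- costs fewer than `wt S` edges, since all of them meet `W`, but adds `S` to the uncovered sets,
  -- raising the objective.
  obtain ⟨E', hE'E, hmax⟩ := Finset.exists_max_image E.powerset
    (fun F => F.card + ∑ S ∈ U F, wt S) ⟨E, Finset.mem_powerset_self E⟩
  rw [Finset.mem_powerset] at hE'E
  refine ⟨E', hE'E, ?_, ?_⟩
  · intro e he S hSe W hSW hW
    by_contra! hbad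
    have hek := hE e (hE'E he)
    have hSk : S.card < k := by
      by_contra! hle
      have hS : S = e := Finset.eq_of_subset_of_card_le hSe (by omega)
      exact hbad e he hSe (hS ▸ hSW)
    obtain ⟨u, -, -⟩ := Finset.not_disjoint_iff.1 (hbad e he hSe)
    have hn : 0 < Fintype.card V := Fintype.card_pos_iff.2 ⟨u⟩
    have hmax' := hmax (E'.filter fun f => ¬ S ⊆ f)
      (Finset.mem_powerset.2 ((Finset.filter_subset _ _).trans hE'E))
    have hsum : wt S + ∑ T ∈ U E', wt T ≤ ∑ T ∈ U (E'.filter fun f => ¬ S ⊆ f), wt T := by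
      have hS : S ∉ U E' := fun h => (Finset.mem_filter.1 h).2 e he hSe
      rw [← Finset.sum_insert hS]
      refine Finset.sum_le_sum_of_subset (Finset.insert_subset ?_ fun T hT => ?_)
      · simp only [U, Finset.mem_filter, Finset.mem_univ, true_and]
        exact ⟨hSk, fun f hf => hf.2⟩
      · simp only [U, Finset.mem_filter, Finset.mem_univ, true_and] at hT ⊢
        exact ⟨hT.1, fun f hf => hT.2 f hf.1⟩
    have hsplit := Finset.card_filter_add_card_filter_not (s := E') fun f => S ⊆ f
    have hdel : (E'.filter fun f => S ⊆ f).card < wt S := by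
      calc _ ≤ (E'.filter fun f => S ⊆ f ∧ ¬ Disjoint f W).card := by
            refine Finset.card_le_card fun f hf => ?_
            obtain ⟨hf, hSf⟩ := Finset.mem_filter.1 hf
            exact Finset.mem_filter.2 ⟨hf, hSf, hbad f hf hSf⟩
        _ ≤ W.card * Fintype.card V ^ (k - 1 - S.card) :=
            card_filter_superset_not_disjoint_le (fun f hf => hE f (hE'E hf)) hSW
        _ < wt S := Nat.mul_lt_mul_of_pos_right (by omega) (by positivity)
    omega
  · have h1 := hmax E (Finset.mem_powerset_self E)
    have h2 : ∑ S ∈ U E', wt S ≤ k * ((w + 1) * Fintype.card V ^ (k - 1)) :=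
      (Finset.sum_le_sum_of_subset (Finset.filter_subset _ _)).trans (sum_pow_card_le k (w + 1))
    omega

end Cleaning

/-! ### Tents in clean families -/

section Tent

variable {V : Type*} [DecidableEq V]

/-- The edges in `hcov` may coincide or overlap arbitrarily; cleanness replaces them by edges that
meet only in `v` and meet the base only in their own blocks. -/
theorem not_free_tent_of_isClean {k w : ℕ} {lam : k.Partition} (h : 2 ≤ lam.len) {G : KGraph k V}
    {E : Finset (Finset V)} (hEG : E ⊆ G.edges) (hw : k + lam.len * k ≤ w) (hclean : IsClean w E)
    {b : (Σ i : Fin lam.len, Fin (lam.part i)) → V} (hb : Function.Injective b)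
    (hbE : Finset.univ.image b ∈ E) {v : V} (hv : ∀ p, b p ≠ v)
    (hcov : ∀ i, ∃ f ∈ E, v ∈ f ∧ ∀ p, b ⟨i, p⟩ ∈ f) : ¬ (lam.tent h).Free G := by
  have hE : ∀ e ∈ E, e.card = k := fun e he => G.uniform e (hEG he)
  let I : Fin lam.len → Finset V := fun i => Finset.univ.image fun p => b ⟨i, p⟩
  have hIcard : ∀ i, (I i).card = lam.part i := by
    intro i
    exact (Finset.card_image_of_injective _ (hb.comp sigma_mk_injective)).trans (by simp)
  have hvI : ∀ i, v ∉ I i := by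
    intro i hi
    obtain ⟨p, -, hp⟩ := Finset.mem_image.1 hi
    exact hv _ hp
  obtain ⟨f, hf, hff⟩ := hclean.exists_disjoint_extensions (I := I) hE (hE _ hbE) (v := v)
    (by simpa [Sigma.forall] using hv) (fun i u hu => by
      obtain ⟨p, -, rfl⟩ := Finset.mem_image.1 hu
      simp) (fun i j hij => by
      rw [Finset.disjoint_left]
      intro u hu hu'
      obtain ⟨p, -, rfl⟩ := Finset.mem_image.1 hu
      obtain ⟨q, -, hq⟩ := Finset.mem_image.1 hu'
      exact hij (congrArg Sigma.fst (hb hq)).symm) (fun i => by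
      obtain ⟨g, hg, hvg, hbg⟩ := hcov i
      refine ⟨g, hg, Finset.insert_subset hvg fun u hu => ?_⟩
      obtain ⟨p, -, rfl⟩ := Finset.mem_image.1 hu
      exact hbg p) Finset.univ (by simpa using hw)
  simp only [Finset.mem_univ, true_imp_iff] at hf hff
  have hR : ∀ i, (f i \ insert v (I i)).card = k - 1 - lam.part i := by
    intro i
    rw [Finset.card_sdiff_of_subset (hf i).2.1, hE _ (hf i).1,
      Finset.card_insert_of_notMem (hvI i), hIcard]
    omega
  let g : ∀ i : Fin lam.len, Fin (k - 1 - lam.part i) ≃ {u // u ∈ f i \ insert v (I i)} := fun i =>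
    (Finset.equivFinOfCardEq (hR i)).symm
  have hg : ∀ i q, (g i q : V) ∈ f i ∧ (g i q : V) ≠ v ∧ (g i q : V) ∉ I i := by
    intro i q
    have := (g i q).2
    simpa only [Finset.mem_sdiff, Finset.mem_insert, not_or] using this
  have hgb : ∀ i q p, (g i q : V) ≠ b p := by
    intro i q p hp
    refine (hg i q).2.2 ((hf i).2.2 (Finset.mem_inter.2 ⟨(hg i q).1, ?_⟩))
    simp [hp]
  let φ : lam.TentVertex → V := Sum.elim b (Sum.elim (fun _ => v) fun p => g p.1 p.2)
  have hφ : Function.Injective φ := by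
    refine hb.sumElim (Function.Injective.sumElim (Function.injective_of_subsingleton _) ?_ ?_) ?_
    · rintro ⟨i, p⟩ ⟨j, q⟩ hpq
      have hij : i = j := by
        by_contra hij
        have := hff i j hij (Finset.mem_inter.2 ⟨(hg i p).1, by
          simp only at hpq
          rw [hpq]; exact (hg j q).1⟩)
        exact (hg i p).2.1 (Finset.mem_singleton.1 this)
      subst hij
      exact congrArg (Sigma.mk i) ((g i).injective (Subtype.ext hpq))
    · rintro - ⟨i, p⟩
      exact (hg i p).2.1.symm
    · rintro p (- | ⟨i, q⟩)
      · exact hv p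
      · exact (hgb i q p).symm
  rw [KGraph.Free, not_not]
  refine ⟨⟨φ, hφ⟩, fun e he => ?_⟩
  have hek := (lam.tent h).uniform e he
  -- Both sets have `k` elements, so inclusion is equality.
  have hmap : ∀ f' ∈ E, e.map ⟨φ, hφ⟩ ⊆ f' → e.map ⟨φ, hφ⟩ ∈ G.edges := by
    intro f' hf' hsub
    rw [Finset.eq_of_subset_of_card_le hsub (by rw [Finset.card_map, hek, hE f' hf'])]
    exact hEG hf'
  rcases Finset.mem_insert.1 he with rfl | he
  · refine hmap _ hbE fun u hu => ?_
    obtain ⟨t, ht, rfl⟩ := Finset.mem_map.1 hu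
    rcases t with p | t
    · simp [φ]
    · simp [Nat.Partition.tentBase] at ht
  · obtain ⟨i, -, rfl⟩ := Finset.mem_image.1 he
    refine hmap _ (hf i).1 fun u hu => ?_
    obtain ⟨t, ht, rfl⟩ := Finset.mem_map.1 hu
    rcases t with p | - | p
    · simp only [Nat.Partition.tentSide, Finset.inl_mem_disjSum, Finset.mem_map, Finset.mem_univ,
        true_and] at ht
      obtain ⟨q, rfl⟩ := ht
      exact (hf i).2.1 (Finset.mem_insert_of_mem (Finset.mem_image_of_mem _ (Finset.mem_univ q)))
    · exact (hf i).2.1 (Finset.mem_insert_self _ _)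
    · simp only [Nat.Partition.tentSide, Finset.inr_mem_disjSum, Finset.mem_map, Finset.mem_univ,
        true_and] at ht
      obtain ⟨q, rfl⟩ := ht
      exact (hg i q).1

variable [Fintype V]

/-- The orderings of the members of `E` as `k`-tuples. -/
def orderedEdges (k : ℕ) (E : Finset (Finset V)) : Finset (Fin k → V) :=
  Finset.univ.filter fun x => Finset.univ.image x ∈ E

theorem mem_orderedEdges {k : ℕ} {E : Finset (Finset V)} {x : Fin k → V} :
    x ∈ orderedEdges k E ↔ Finset.univ.image x ∈ E := by
  simp [orderedEdges]

theorem injective_of_mem_orderedEdges {k : ℕ} {E : Finset (Finset V)} (hE : ∀ e ∈ E, e.card = k)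
    {x : Fin k → V} (hx : x ∈ orderedEdges k E) : Function.Injective x := by
  rw [← Set.injOn_univ, ← Finset.coe_univ, ← Finset.card_image_iff, hE _ (mem_orderedEdges.1 hx)]
  simp

theorem factorial_mul_card_le_card_orderedEdges {k : ℕ} {E : Finset (Finset V)}
    (hE : ∀ e ∈ E, e.card = k) : k.factorial * E.card ≤ (orderedEdges k E).card := by
  refine Finset.mul_card_image_le_card_of_maps_to (f := fun x => Finset.univ.image x) (t := E)
    (fun x hx => mem_orderedEdges.1 hx) _ fun e he => ?_
  let g : Fin k ≃ {u // u ∈ e} := (Finset.equivFinOfCardEq (hE e he)).symm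
  have himage : ∀ σ : Equiv.Perm (Fin k), Finset.univ.image (fun i => (g (σ i) : V)) = e := by
    intro σ
    refine Finset.eq_of_subset_of_card_le (fun u hu => ?_) ?_
    · obtain ⟨i, -, rfl⟩ := Finset.mem_image.1 hu
      exact (g (σ i)).2
    · have hinj : Function.Injective fun i => (g (σ i) : V) :=
        Subtype.val_injective.comp (g.injective.comp σ.injective)
      rw [Finset.card_image_of_injective _ hinj, hE e he]
      simp
  calc k.factorial = (Finset.univ : Finset (Equiv.Perm (Fin k))).card := by
        rw [Finset.card_univ, Fintype.card_perm, Fintype.card_fin]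
    _ ≤ _ := by
        refine Finset.card_le_card_of_injOn (fun σ i => (g (σ i) : V)) (fun σ _ => ?_) ?_
        · simp [mem_orderedEdges, himage, he]
        · intro σ _ τ _ hστ
          ext i
          have := congrFun hστ i
          rw [g.injective (Subtype.ext this)]

theorem orderedEdges_symm {k : ℕ} {E : Finset (Finset V)} {x : Fin k → V}
    (hx : x ∈ orderedEdges k E) (σ : Equiv.Perm (Fin k)) : x ∘ σ ∈ orderedEdges k E := by
  rw [mem_orderedEdges] at hx ⊢
  rwa [← Finset.image_image, Finset.image_univ_equiv]

/-- A common extension `v` is an apex over the base `x`: the edge of `z` covers blocks inside `A`,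
that of `z'` blocks inside `B`. -/
theorem not_mem_extensions_inter_of_free_tent {k w : ℕ} {lam : k.Partition} (h : 2 ≤ lam.len)
    (hrest : ∀ i : ℕ, 0 < i → i < lam.len → lam.part i = 1) {G : KGraph k V}
    (hG : (lam.tent h).Free G) {E : Finset (Finset V)} (hEG : E ⊆ G.edges)
    (hw : k + lam.len * k ≤ w) (hclean : IsClean w E) {x : Fin k → V} (hx : x ∈ orderedEdges k E)
    {A B : Finset (Fin k)} (hAB : A ∪ B = Finset.univ) {i j : Fin k} (hi : i ∉ A) (hj : j ∉ B)
    (hA : lam.part 0 ≤ A.card) {v : V} (hvA : v ∈ extensions (orderedEdges k E) A i x)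
    (hvB : v ∈ extensions (orderedEdges k E) B j x) : False := by
  have hE : ∀ e ∈ E, e.card = k := fun e he => G.uniform e (hEG he)
  obtain ⟨z, hz, hzA, hzi⟩ := mem_extensions.1 hvA
  obtain ⟨z', hz', hzB, hzj⟩ := mem_extensions.1 hvB
  have hzinj := injective_of_mem_orderedEdges hE hz
  have hzinj' := injective_of_mem_orderedEdges hE hz'
  have hor : ∀ l, l ∈ A ∨ l ∈ B := fun l => Finset.mem_union.1 (hAB ▸ Finset.mem_univ l)
  -- If `v = x l` with `l ∈ A`, then `z` takes the value `v` at both `l` and `i ∉ A`, against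
  -- injectivity; likewise for `B`.
  have hvx : ∀ l, x l ≠ v := by
    rintro l rfl
    rcases hor l with hl | hl
    · exact hi (hzinj (hzi.trans (hzA l hl).symm) ▸ hl)
    · exact hj (hzinj' (hzj.trans (hzB l hl).symm) ▸ hl)
  have hcard : Fintype.card (Σ i : Fin lam.len, Fin (lam.part i)) = k := by
    simp [lam.sum_part]
  let i₀ : Fin lam.len := ⟨0, by omega⟩
  obtain ⟨τ, hτ⟩ : ∃ τ : (Σ i : Fin lam.len, Fin (lam.part i)) ≃ Fin k, ∀ p, τ ⟨i₀, p⟩ ∈ A := by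
    obtain ⟨A', hA'A, hA'⟩ := Finset.exists_subset_card_eq hA
    let τ₀ := Fintype.equivFinOfCardEq hcard
    have hinj : Function.Injective fun p => τ₀ ⟨i₀, p⟩ := τ₀.injective.comp sigma_mk_injective
    obtain ⟨σ, hσ⟩ := exists_perm_map_eq (A := Finset.univ.image fun p => τ₀ ⟨i₀, p⟩) (B := A')
      (by rw [Finset.card_image_of_injective _ hinj, hA', Finset.card_univ, Fintype.card_fin])
    refine ⟨τ₀.trans σ, fun p => hA'A ?_⟩
    rw [← hσ]
    exact Finset.mem_map_of_mem _ (Finset.mem_image_of_mem _ (Finset.mem_univ p))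
  refine not_free_tent_of_isClean h hEG hw hclean (b := x ∘ τ)
    ((injective_of_mem_orderedEdges hE hx).comp τ.injective) ?_ (v := v) (fun p => hvx _) ?_ hG
  · rw [← Finset.image_image, Finset.image_univ_equiv]
    exact mem_orderedEdges.1 hx
  · have hcovA : ∀ l, (∀ p, τ ⟨l, p⟩ ∈ A) → ∃ f ∈ E, v ∈ f ∧ ∀ p, (x ∘ τ) ⟨l, p⟩ ∈ f :=
      fun l hl => ⟨_, mem_orderedEdges.1 hz, hzi ▸ Finset.mem_image_of_mem z (Finset.mem_univ i),
        fun p => Finset.mem_image.2 ⟨_, Finset.mem_univ _, hzA _ (hl p)⟩⟩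
    have hcovB : ∀ l, (∀ p, τ ⟨l, p⟩ ∈ B) → ∃ f ∈ E, v ∈ f ∧ ∀ p, (x ∘ τ) ⟨l, p⟩ ∈ f :=
      fun l hl => ⟨_, mem_orderedEdges.1 hz', hzj ▸ Finset.mem_image_of_mem z' (Finset.mem_univ j),
        fun p => Finset.mem_image.2 ⟨_, Finset.mem_univ _, hzB _ (hl p)⟩⟩
    intro l
    by_cases hl : l = i₀
    · exact hl ▸ hcovA i₀ hτ
    · have hl1 : lam.part l = 1 := hrest l (Nat.pos_of_ne_zero fun h0 => hl (Fin.ext h0)) l.2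
      have hsub : ∀ p q : Fin (lam.part l), p = q := fun p q => Fin.ext (by omega)
      rcases hor (τ ⟨l, ⟨0, by omega⟩⟩) with h' | h'
      · exact hcovA l fun p => hsub ⟨0, by omega⟩ p ▸ h'
      · exact hcovB l fun p => hsub ⟨0, by omega⟩ p ▸ h'

/-- A tent-free `k`-graph on `n` vertices has at most `(n / k) ^ k + O(n ^ (k - 1))` edges. -/
theorem card_edges_le_of_free_tent {k : ℕ} (hk : 2 ≤ k) {lam : k.Partition} (h : 2 ≤ lam.len)
    (hfirst : 2 * lam.part 0 ≤ k + 1) (hrest : ∀ i : ℕ, 0 < i → i < lam.len → lam.part i = 1)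
    {G : KGraph k V} (hG : (lam.tent h).Free G) :
    (G.edges.card : ℝ) ≤ ((Fintype.card V : ℝ) / k) ^ k
      + k * ((k + lam.len * k + 1 : ℝ) * (Fintype.card V : ℝ) ^ (k - 1)) := by
  obtain ⟨E, hEG, hclean, hcard⟩ := exists_isClean G.uniform (k + lam.len * k)
  have hE : ∀ e ∈ E, e.card = k := fun e he => G.uniform e (hEG he)
  have hΩ := card_le_of_disjoint_extensions (by omega : 1 ≤ k) (Ω := orderedEdges k E)
    (fun x hx σ => orderedEdges_symm hx σ) (by
      intro x hx A B hAB i hi j hj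
      rw [Finset.disjoint_left]
      intro v hvA hvB
      have hle := Finset.card_union_le A B
      rw [hAB, Finset.card_univ, Fintype.card_fin] at hle
      -- As `|A| + |B| ≥ k` and `2 λ₁ ≤ k + 1`, at least one of `A`, `B` has room for the largest
      -- block.
      by_cases hA : lam.part 0 ≤ A.card
      · exact not_mem_extensions_inter_of_free_tent h hrest hG hEG le_rfl hclean hx hAB hi hj hA
          hvA hvB
      · exact not_mem_extensions_inter_of_free_tent h hrest hG hEG le_rfl hclean hx
          (Finset.union_comm A B ▸ hAB) hj hi (by omega) hvB hvA)
  have h1 : (k.factorial * E.card : ℝ) ≤ (orderedEdges k E).card := by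
    exact_mod_cast factorial_mul_card_le_card_orderedEdges hE
  have h2 : (E.card : ℝ) ≤ ((Fintype.card V : ℝ) / k) ^ k :=
    le_of_mul_le_mul_left (h1.trans hΩ) (by exact_mod_cast k.factorial_pos)
  have h3 : (G.edges.card : ℝ) ≤ E.card
      + k * ((k + lam.len * k + 1 : ℝ) * (Fintype.card V : ℝ) ^ (k - 1)) := by
    exact_mod_cast hcard
  linarith

end Tent

/-! ### The extremal construction -/

/-- The complete `k`-partite `k`-graph on `n` vertices whose parts are the residue classes
modulo `k`. -/
def residuePartite (k n : ℕ) [NeZero k] : KGraph k (Fin n) where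
  edges := (Finset.univ.powersetCard k).filter fun e =>
    e.image (fun v : Fin n => Fin.ofNat k (v : ℕ)) = Finset.univ
  uniform := fun _ he => (Finset.mem_powersetCard.1 (Finset.mem_filter.1 he).1).2

theorem mem_edges_residuePartite {k n : ℕ} [NeZero k] {e : Finset (Fin n)} :
    e ∈ (residuePartite k n).edges ↔
      e.card = k ∧ e.image (fun v : Fin n => Fin.ofNat k (v : ℕ)) = Finset.univ := by
  simp [residuePartite, Finset.mem_powersetCard]

/-- Independent choices of a quotient below `n / k` for each residue give distinct edges. -/
theorem pow_div_le_card_edges_residuePartite (k n : ℕ) [NeZero k] :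
    (n / k) ^ k ≤ (residuePartite k n).edges.card := by
  let p : (Fin k → Fin (n / k)) → Fin k → Fin n := fun g i =>
    ⟨g i * k + i, by
      have h1 := (g i).2
      have h2 := i.2
      calc (g i : ℕ) * k + i < (g i + 1) * k := by rw [add_mul]; omega
        _ ≤ (n / k) * k := Nat.mul_le_mul_right k h1
        _ ≤ n := Nat.div_mul_le_self n k⟩
  have hp : ∀ g i, Fin.ofNat k (p g i : ℕ) = i := by
    intro g i
    ext
    simp [p, Fin.ofNat, Nat.mod_eq_of_lt i.2]
  have hinj : ∀ g, Function.Injective (p g) := fun g i j hij => by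
    rw [← hp g i, ← hp g j, hij]
  calc (n / k) ^ k = (Finset.univ : Finset (Fin k → Fin (n / k))).card := by simp
    _ ≤ _ := by
      refine Finset.card_le_card_of_injOn (fun g => Finset.univ.image (p g)) (fun g _ => ?_) ?_
      · rw [Finset.mem_coe, mem_edges_residuePartite]
        refine ⟨by rw [Finset.card_image_of_injective _ (hinj g)]; simp, ?_⟩
        ext i
        simp only [Finset.mem_image, Finset.mem_univ, true_and, iff_true]
        exact ⟨p g i, ⟨i, rfl⟩, hp g i⟩
      · intro g _ g' _ hgg
        funext i
        have hmem : p g i ∈ Finset.univ.image (p g') := by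
          rw [← show Finset.univ.image (p g) = Finset.univ.image (p g') from hgg]
          exact Finset.mem_image_of_mem _ (Finset.mem_univ i)
        obtain ⟨j, -, hj⟩ := Finset.mem_image.1 hmem
        have hji : j = i := by rw [← hp g' j, hj, hp g i]
        subst hji
        have hk : 0 < k := Nat.pos_of_ne_zero (NeZero.ne k)
        have h2 : (g' j : ℕ) * k + j = g j * k + j := congrArg Fin.val hj
        exact Fin.ext (Nat.eq_of_mul_eq_mul_right hk (by omega)).symm

theorem free_tent_residuePartite {k : ℕ} [NeZero k] {lam : k.Partition} (h : 2 ≤ lam.len)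
    (n : ℕ) : (lam.tent h).Free (residuePartite k n) := by
  rintro ⟨f, hf⟩
  let c : Fin n → Fin k := fun v => Fin.ofNat k (v : ℕ)
  let apex : lam.TentVertex := Sum.inr (Sum.inl ())
  have hbase := mem_edges_residuePartite.1 (hf lam.tentBase (Finset.mem_insert_self _ _))
  have hapex : c (f apex) ∈ (lam.tentBase.map f).image c := hbase.2 ▸ Finset.mem_univ _
  obtain ⟨u, hu, huc⟩ := Finset.mem_image.1 hapex
  obtain ⟨t, ht, rfl⟩ := Finset.mem_map.1 hu
  rcases t with ⟨i, p⟩ | t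
  -- The base vertex in the class of the apex belongs to block `i`, so the side edge `i` repeats a
  -- class.
  · have hside := mem_edges_residuePartite.1 (hf (lam.tentSide i)
      (Finset.mem_insert_of_mem (Finset.mem_image_of_mem _ (Finset.mem_univ i))))
    have hinj : Set.InjOn c ((lam.tentSide i).map f) := by
      rw [← Finset.card_image_iff, hside.1]
      change (Finset.image (fun v : Fin n => Fin.ofNat k (v : ℕ)) _).card = k
      rw [hside.2]
      simp
    have hmem : ∀ t ∈ lam.tentSide i, f t ∈ ((lam.tentSide i).map f : Set (Fin n)) :=
      fun t ht => Finset.mem_coe.2 (Finset.mem_map_of_mem f ht)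
    have := f.injective (hinj (hmem _ (by simp [Nat.Partition.tentSide]))
      (hmem apex (by simp [apex, Nat.Partition.tentSide])) huc)
    simp [apex] at this
  · simp [Nat.Partition.tentBase] at ht

/-! ### The limit -/

theorem tendsto_pow_div_choose (k : ℕ) :
    Tendsto (fun n : ℕ => (n : ℝ) ^ k / (n.choose k : ℝ)) atTop (𝓝 (k.factorial : ℝ)) := by
  have hk : (k.factorial : ℝ) ≠ 0 := by exact_mod_cast k.factorial_ne_zero
  have h := (isEquivalent_choose k).symm
  have hne : ∀ᶠ n : ℕ in atTop, (n.choose k : ℝ) ≠ 0 := by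
    filter_upwards [eventually_ge_atTop k] with n hn
    exact_mod_cast (Nat.choose_pos hn).ne'
  have h1 := ((Asymptotics.isEquivalent_iff_tendsto_one hne).1 h).mul_const (k.factorial : ℝ)
  rw [one_mul] at h1
  refine h1.congr fun n => ?_
  simp only [Pi.div_apply]
  field_simp

theorem theorem1p5 (k : ℕ) (hk : 2 ≤ k) (lam : k.Partition)
    (hfirst : lam.part 0 ≤ ⌈(k : ℝ) / 2⌉₊)
    (hrest : ∀ i : ℕ, 0 < i → i < lam.len → lam.part i = 1) :
    (lam.tent (Nat.Partition.two_le_len hk lam hfirst)).HasTuranDensity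
      ((k.factorial : ℝ) / (k : ℝ) ^ k) := by
  have h := Nat.Partition.two_le_len hk lam hfirst
  have : NeZero k := ⟨by omega⟩
  have hk0 : (0 : ℝ) < k := by exact_mod_cast (by omega : 0 < k)
  have hfirst' : 2 * lam.part 0 ≤ k + 1 := by
    have h1 : (lam.part 0 : ℝ) < (k : ℝ) / 2 + 1 :=
      lt_of_le_of_lt (by exact_mod_cast hfirst) (Nat.ceil_lt_add_one (by positivity))
    have h2 : (2 * lam.part 0 : ℝ) < k + 2 := by linarith
    have h3 : 2 * lam.part 0 < k + 2 := by exact_mod_cast h2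
    omega
  have hmax : ∀ n, IsGreatest {m : ℕ | ∃ G : KGraph k (Fin n), (lam.tent h).Free G ∧
      G.edges.card = m} ((lam.tent h).ex n) := fun n =>
    KGraph.ex_isGreatest n _ ⟨lam.tentBase, Finset.mem_insert_self _ _⟩
  have hpow := tendsto_pow_div_choose k
  -- The constant of the cleaning error; its contribution is `K / n` once `n ^ k` is factored out.
  let K : ℝ := k * (k + lam.len * k + 1)
  have hlower : Tendsto (fun n : ℕ => (((n / k : ℕ) : ℝ) / n) ^ k *
      ((n : ℝ) ^ k / (n.choose k : ℝ))) atTop (𝓝 ((k.factorial : ℝ) / (k : ℝ) ^ k)) := by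
    have h1 : Tendsto (fun n : ℕ => (((n / k : ℕ) : ℝ) / n)) atTop (𝓝 (1 / k)) := by
      have h2 := (tendsto_nat_floor_mul_div_atTop (R := ℝ) (a := 1 / k) (by positivity)).comp
        tendsto_natCast_atTop_atTop
      refine h2.congr fun n => ?_
      simp only [Function.comp_apply]
      rw [one_div_mul_eq_div, Nat.floor_div_eq_div]
    have h3 := (h1.pow k).mul hpow
    rwa [one_div, inv_pow, inv_mul_eq_div] at h3
  have hupper : Tendsto (fun n : ℕ => (1 / (k : ℝ) ^ k + K * (1 / (n : ℝ))) *
      ((n : ℝ) ^ k / (n.choose k : ℝ))) atTop (𝓝 ((k.factorial : ℝ) / (k : ℝ) ^ k)) := by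
    have h3 := ((tendsto_const_nhds (x := 1 / (k : ℝ) ^ k)).add
      ((tendsto_one_div_atTop_nhds_zero_nat (𝕜 := ℝ)).const_mul K)).mul hpow
    rwa [mul_zero, add_zero, one_div_mul_eq_div] at h3
  refine tendsto_of_tendsto_of_tendsto_of_le_of_le' hlower hupper ?_ ?_
  · filter_upwards [eventually_gt_atTop 0] with n hn
    have hn0 : (0 : ℝ) < n := by exact_mod_cast hn
    have h1 : (((n / k : ℕ) : ℝ)) ^ k ≤ (lam.tent h).ex n := by
      exact_mod_cast (pow_div_le_card_edges_residuePartite k n).trans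
        ((hmax n).2 ⟨residuePartite k n, free_tent_residuePartite h n, rfl⟩)
    rw [div_pow, div_mul_div_cancel₀ (by positivity)]
    gcongr
  · filter_upwards [eventually_gt_atTop 0] with n hn
    have hn0 : (0 : ℝ) < n := by exact_mod_cast hn
    obtain ⟨G, hG, hGc⟩ := (hmax n).1
    have h1 := card_edges_le_of_free_tent hk h hfirst' hrest hG
    rw [hGc, Fintype.card_fin] at h1
    rw [← mul_div_assoc]
    gcongr
    refine h1.trans (le_of_eq ?_)
    obtain ⟨m, rfl⟩ : ∃ m, k = m + 1 := ⟨k - 1, by omega⟩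
    simp only [K, Nat.add_sub_cancel]
    rw [pow_succ (n : ℝ) m, div_pow, pow_succ (n : ℝ) m]
    field_simp
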